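/- Let $0<q<1$, let $\phi(z)=\sum_{n\ge 1}\phi_n z^n$ be a real power series (so $\phi(0)=0$), and put $f(z)=z(1-\phi(z))=\sum_{n\ge1}f_nz^n$. Let $g(z)=\sum_{n\ge 1}g_nz^n$ be the formal power series without constant term that satisfies $$\sum_{n\ge 1} f_n\, g(z)\,g(z/q)\cdots g(z/q^{n-1})=z .$$ Assume that (i) $\phi_n\ge 0$ for all $n$; (ii) $\displaystyle\limsup_{n\to\infty}\frac{\log\phi_n}{n\log n}<-2$, where $\log 0=-\infty$ (in particular $\phi$ is an entire function); (iii) $\zeta>0$ is such that $\phi(\zeta)=1$, and $\phi(z)=1-(1-z/\zeta)\,\theta(z)$ for a meromorphic function $\theta$ on $\mathbb C$ that has no root in the closed disk $\{|z|\le\zeta\}$. Then, as $n\to\infty$, $$g_n\sim\frac{1}{q^{\binom n2}\,\zeta^n\,\phi'(\zeta)\,(q;q)_\infty\prod_{j\ge1}\theta(\zeta q^j)},$$ that is, the ratio of the two sides tends to $1$. Here $(q;q)_\infty=\prod_{j\ge1}(1-q^j)$, $\phi$ is differentiable at $\zeta$, and the product of the $\theta(\zeta q^j)$ converges. -/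

import Mathlib

open Filter Topology
open scoped PowerSeries

namespace QLagrange

/-- The product `g(z) g(z/q) ⋯ g(z/q^(n-1))` of formal power series. -/
noncomputable def qPower (q : ℝ) (g : ℝ⟦X⟧) (n : ℕ) : ℝ⟦X⟧ :=
  ∏ i ∈ Finset.range n, PowerSeries.rescale ((q⁻¹) ^ i) g

/-- If `g` has no constant term, then `g(z) ⋯ g(z/q^(n-1))` has no coefficient of degree `m < n`.
Hence only the indices `n ≤ m` contribute to the coefficient of `z^m` in
`∑_{n ≥ 1} f_n g(z) ⋯ g(z/q^(n-1))`. -/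
theorem coeff_qPower_of_lt (q : ℝ) (g : ℝ⟦X⟧) (hg : PowerSeries.constantCoeff g = 0)
    {m n : ℕ} (hmn : m < n) : PowerSeries.coeff m (qPower q g n) = 0 := by
  have h : (PowerSeries.X : ℝ⟦X⟧) ^ n ∣ qPower q g n := by
    have h1 : (PowerSeries.X : ℝ⟦X⟧) ^ n = ∏ _i ∈ Finset.range n, (PowerSeries.X : ℝ⟦X⟧) := by
      simp
    rw [h1]
    refine Finset.prod_dvd_prod_of_dvd _ _ fun i _ => ?_
    rw [PowerSeries.X_dvd_iff, ← PowerSeries.coeff_zero_eq_constantCoeff_apply,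
      PowerSeries.coeff_rescale]
    simp [hg]
  exact PowerSeries.X_pow_dvd_iff.mp h m hmn

/-- `g` is the right inverse of `f`: `g` has no constant term and
`∑_{n ≥ 1} f_n g(z) g(z/q) ⋯ g(z/q^(n-1)) = z` as formal power series, that is,
coefficient by coefficient. In degree `m` the terms with `n > m` vanish. -/
def IsRightInverse (q : ℝ) (f g : ℝ⟦X⟧) : Prop :=
  PowerSeries.constantCoeff g = 0 ∧
    ∀ m : ℕ, ∑ n ∈ Finset.Icc 1 m, PowerSeries.coeff n f * PowerSeries.coeff m (qPower q g n) =
      PowerSeries.coeff m (PowerSeries.X : ℝ⟦X⟧)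

/-- The function `z ↦ ∑ φ_n z^n` of a complex variable. -/
noncomputable def toFun (φ : ℝ⟦X⟧) (z : ℂ) : ℂ :=
  ∑' n : ℕ, ((PowerSeries.coeff n φ : ℝ) : ℂ) * z ^ n

/-- `log φ_n / (n log n)` as an extended real number, with `log 0 = -∞`
(meaningful for `φ_n ≥ 0` and `n ≥ 2`). -/
noncomputable def logRatio (φ : ℝ⟦X⟧) (n : ℕ) : EReal :=
  ENNReal.log (ENNReal.ofReal (PowerSeries.coeff n φ)) / (((n : ℝ) * Real.log n : ℝ) : EReal)

/-- `(a; q)_∞ = ∏_{j ≥ 0} (1 - a q^j)`. -/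
noncomputable def qPochhammerInf (a q : ℝ) : ℝ := ∏' j : ℕ, (1 - a * q ^ j)

/-- The infinite product defining `(a; q)_∞` converges when `|q| < 1`. -/
theorem multipliable_qPochhammerInf (a q : ℝ) (hq : |q| < 1) :
    Multipliable fun j : ℕ => 1 - a * q ^ j := by
  have h : Summable fun j : ℕ => ‖-(a * q ^ j)‖ := by
    simpa [norm_mul, norm_pow] using
      (summable_geometric_of_lt_one (abs_nonneg q) hq).mul_left |a|
  simpa [sub_eq_add_neg] using multipliable_one_add_of_summable h

end QLagrange

namespace QLagrange

/-! ### Right inverses are unique -/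

/-! Let `C(z) = ∑ c_n z^n` be the product of all `1 / (1 - φ(q^j z))` with `j ≥ 0`, so that `(1 -
φ(z)) C(z) = C(qz)`, and let `B(z) = ∑ q^(-n(n-1)/2) c_n z^n`. The right inverse is `g(z) = z B(z/q)
/ B(z)`: the products `g(z) ⋯ g(z/q^(n-1))` telescope, and the defining equation becomes the
functional equation of `C` (`isRightInverse_denomSeries`, with uniqueness of right inverses).

Put `d_n = c_n ζ^n` and `x_n = g_(n+1) ζ^n q^(n(n+1)/2)`. Comparing coefficients in `g B = z B(z/q)`
gives `x_n = d_n` minus a sum whose terms carry powers of `q` of exponent at least `n`. Hence `x`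
and `d` have the same limit (`tendsto_of_perturbed_recursion`).

To find that limit, write `C(z) = C(qz) / (1 - φ(z))`. The only zero of `1 - φ` in the closed disk
is the simple one at `ζ`, so the coefficients `u_n` of `1 / (1 - φ)` satisfy `ζ^(n+1) u_n → 1 /
φ'(ζ)` (`tendsto_pow_mul_coeff_inv`). Dominated convergence gives `ζ d_n → C(qζ) / φ'(ζ)`. Iterating
the functional equation, `C(qζ)` is the reciprocal of the product of `1 - φ(ζ q^j) = (1 - q^j) θ(ζ
q^j)` over `j ≥ 1`. -/

theorem X_dvd_qPower (q : ℝ) {g : ℝ⟦X⟧} (hg : PowerSeries.constantCoeff g = 0) {n : ℕ}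
    (hn : 1 ≤ n) : (PowerSeries.X : ℝ⟦X⟧) ∣ qPower q g n := by
  rw [PowerSeries.X_dvd_iff, ← PowerSeries.coeff_zero_eq_constantCoeff_apply]
  exact coeff_qPower_of_lt q g hg hn

theorem qPower_succ (q : ℝ) (g : ℝ⟦X⟧) (n : ℕ) :
    qPower q g (n + 1) = qPower q g n * PowerSeries.rescale ((q⁻¹) ^ n) g :=
  Finset.prod_range_succ _ _

theorem qPower_one (q : ℝ) (g : ℝ⟦X⟧) : qPower q g 1 = g := by
  simp [qPower, PowerSeries.rescale_one]

theorem X_pow_dvd_rescale {a : ℝ} {m : ℕ} {h : ℝ⟦X⟧} (hh : (PowerSeries.X : ℝ⟦X⟧) ^ m ∣ h) :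
    (PowerSeries.X : ℝ⟦X⟧) ^ m ∣ PowerSeries.rescale a h := by
  rw [PowerSeries.X_pow_dvd_iff] at hh ⊢
  intro k hk
  rw [PowerSeries.coeff_rescale, hh k hk, mul_zero]

/-- Every factor is divisible by `X`, so a product of at least two factors gains one order of
agreement over `g` and `h`. Thus, in degree `m`, only the linear term of `f` sees the coefficient
`g_m`. -/
theorem X_pow_succ_dvd_qPower_sub (q : ℝ) {g h : ℝ⟦X⟧}
    (hg : PowerSeries.constantCoeff g = 0) (hh : PowerSeries.constantCoeff h = 0)
    {m : ℕ} (hgh : (PowerSeries.X : ℝ⟦X⟧) ^ m ∣ g - h) {n : ℕ} (hn : 1 ≤ n) :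
    (PowerSeries.X : ℝ⟦X⟧) ^ m ∣ qPower q g n - qPower q h n ∧
      (PowerSeries.X : ℝ⟦X⟧) ^ (m + 1) ∣ qPower q g (n + 1) - qPower q h (n + 1) := by
  have step : ∀ n, 1 ≤ n → (PowerSeries.X : ℝ⟦X⟧) ^ m ∣ qPower q g n - qPower q h n →
      (PowerSeries.X : ℝ⟦X⟧) ^ (m + 1) ∣ qPower q g (n + 1) - qPower q h (n + 1) := by
    intro n hn hd
    have e : qPower q g (n + 1) - qPower q h (n + 1) =
        PowerSeries.rescale ((q⁻¹) ^ n) (g - h) * qPower q g n +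
          (qPower q g n - qPower q h n) * PowerSeries.rescale ((q⁻¹) ^ n) h := by
      rw [qPower_succ, qPower_succ, map_sub]; ring
    rw [e, pow_succ]
    refine dvd_add (mul_dvd_mul (X_pow_dvd_rescale hgh) (X_dvd_qPower q hg hn))
      (mul_dvd_mul hd ?_)
    have := X_pow_dvd_rescale (a := (q⁻¹) ^ n) (m := 1) (h := h)
      (by simpa using PowerSeries.X_dvd_iff.mpr hh)
    simpa using this
  have base : (PowerSeries.X : ℝ⟦X⟧) ^ m ∣ qPower q g n - qPower q h n := by
    induction n, hn using Nat.le_induction with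
    | base => simpa [qPower_one] using hgh
    | succ n hn ih => exact (pow_dvd_pow _ (Nat.le_succ m)).trans (step n hn ih)
  exact ⟨base, step n hn base⟩

theorem IsRightInverse.unique {q : ℝ} {f g h : ℝ⟦X⟧} (hf : PowerSeries.coeff 1 f ≠ 0)
    (hg : IsRightInverse q f g) (hh : IsRightInverse q f h) : g = h := by
  have key : ∀ m, (PowerSeries.X : ℝ⟦X⟧) ^ m ∣ g - h := by
    intro m
    induction m with
    | zero => simp
    | succ m ih =>
      rw [PowerSeries.X_pow_dvd_iff]
      intro k hk
      rcases Nat.lt_succ_iff_lt_or_eq.mp hk with hk | rfl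
      · exact PowerSeries.X_pow_dvd_iff.mp ih k hk
      rcases Nat.eq_zero_or_pos k with rfl | hpos
      · simp [hg.1, hh.1]
      have h1 := (hg.2 k).trans (hh.2 k).symm
      have hmem : 1 ∈ Finset.Icc 1 k := by simp; omega
      rw [← Finset.add_sum_erase _ _ hmem, ← Finset.add_sum_erase _ _ hmem] at h1
      have h2 : ∑ n ∈ (Finset.Icc 1 k).erase 1,
            PowerSeries.coeff n f * PowerSeries.coeff k (qPower q g n) =
          ∑ n ∈ (Finset.Icc 1 k).erase 1,
            PowerSeries.coeff n f * PowerSeries.coeff k (qPower q h n) := by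
        refine Finset.sum_congr rfl fun n hn => ?_
        simp only [Finset.mem_erase, Finset.mem_Icc] at hn
        obtain ⟨n, rfl⟩ : ∃ j, n = j + 1 := ⟨n - 1, by omega⟩
        have h3 := (X_pow_succ_dvd_qPower_sub q hg.1 hh.1 ih (n := n) (by omega)).2
        have h4 := PowerSeries.X_pow_dvd_iff.mp h3 k (by omega)
        rw [map_sub, sub_eq_zero] at h4
        rw [h4]
      rw [h2, add_left_inj, qPower_one, qPower_one] at h1
      rw [map_sub, mul_left_cancel₀ hf h1, sub_self]
  ext k
  have := PowerSeries.X_pow_dvd_iff.mp (key (k + 1)) k (Nat.lt_succ_self k)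
  rwa [map_sub, sub_eq_zero] at this

/-! ### The right inverse through a linear recursion -/

/-- The coefficients of `∏_{j ≥ 0} 1 / (1 - φ(q^j z))`. -/
noncomputable def prodCoeff (q : ℝ) (φ : ℝ⟦X⟧) : ℕ → ℝ
  | 0 => 1
  | m + 1 => (∑ k : Fin (m + 1), PowerSeries.coeff (m + 1 - k) φ * prodCoeff q φ k) /
      (1 - q ^ (m + 1))

theorem prodCoeff_zero (q : ℝ) (φ : ℝ⟦X⟧) : prodCoeff q φ 0 = 1 := by
  rw [prodCoeff]

theorem prodCoeff_mul {q : ℝ} (hq0 : 0 < q) (hq1 : q < 1) (φ : ℝ⟦X⟧) (m : ℕ) :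
    prodCoeff q φ m * (1 - q ^ m) =
      ∑ k ∈ Finset.range m, PowerSeries.coeff (m - k) φ * prodCoeff q φ k := by
  cases m with
  | zero => simp
  | succ m =>
    have : 1 - q ^ (m + 1) ≠ 0 := (sub_pos.mpr (pow_lt_one₀ hq0.le hq1 (by simp))).ne'
    rw [prodCoeff, div_mul_cancel₀ _ this,
      Finset.sum_range fun k => PowerSeries.coeff (m + 1 - k) φ * prodCoeff q φ k]

theorem one_sub_mul_mk_prodCoeff {q : ℝ} (hq0 : 0 < q) (hq1 : q < 1) {φ : ℝ⟦X⟧}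
    (hφ0 : PowerSeries.constantCoeff φ = 0) :
    (1 - φ) * PowerSeries.mk (prodCoeff q φ) =
      PowerSeries.rescale q (PowerSeries.mk (prodCoeff q φ)) := by
  ext m
  have h := prodCoeff_mul hq0 hq1 φ m
  rw [sub_mul, one_mul, map_sub, PowerSeries.coeff_rescale, PowerSeries.coeff_mk,
    mul_comm φ, PowerSeries.coeff_mul, Finset.Nat.sum_antidiagonal_eq_sum_range_succ
      (fun i j => PowerSeries.coeff i (PowerSeries.mk (prodCoeff q φ)) * PowerSeries.coeff j φ),
    Finset.sum_range_succ]
  simp only [PowerSeries.coeff_mk, Nat.sub_self, PowerSeries.coeff_zero_eq_constantCoeff, hφ0,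
    mul_zero, add_zero]
  simp only [mul_comm (PowerSeries.coeff _ φ)] at h
  linarith

theorem choose_two_add (a b : ℕ) :
    (a + b).choose 2 = a.choose 2 + b.choose 2 + a * b := by
  induction b with
  | zero => simp
  | succ b ih =>
    rw [← add_assoc, Nat.choose_succ_succ' (a + b) 1, Nat.choose_succ_succ' b 1, ih]
    simp
    ring

/-- The series `∑ q^(-n(n-1)/2) c_n z^n`, with `c_n` the coefficients of
`∏_{j ≥ 0} 1 / (1 - φ(q^j z))`. -/
noncomputable def denomSeries (q : ℝ) (φ : ℝ⟦X⟧) : ℝ⟦X⟧ :=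
  PowerSeries.mk fun n => (q⁻¹) ^ n.choose 2 * prodCoeff q φ n

theorem constantCoeff_denomSeries (q : ℝ) (φ : ℝ⟦X⟧) :
    PowerSeries.constantCoeff (denomSeries q φ) = 1 := by
  rw [← PowerSeries.coeff_zero_eq_constantCoeff_apply]
  simp [denomSeries, prodCoeff_zero]

/-- The factors `g(z/q^i) = z q^(-i) B(z/q^(i+1)) / B(z/q^i)` telescope. -/
theorem qPower_mul_denom (q : ℝ) {g B : ℝ⟦X⟧}
    (h : g * B = PowerSeries.X * PowerSeries.rescale q⁻¹ B) (n : ℕ) :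
    qPower q g n * B = PowerSeries.C ((q⁻¹) ^ n.choose 2) * PowerSeries.X ^ n *
      PowerSeries.rescale ((q⁻¹) ^ n) B := by
  induction n with
  | zero => simp [qPower, PowerSeries.rescale_one]
  | succ n ih =>
    have h2 := congrArg (PowerSeries.rescale ((q⁻¹) ^ n)) h
    rw [map_mul, map_mul, PowerSeries.rescale_X, PowerSeries.rescale_rescale, ← pow_succ'] at h2
    have h3 : (n + 1).choose 2 = n.choose 2 + n := by simpa using choose_two_add n 1
    rw [qPower_succ, mul_right_comm, ih, mul_assoc, mul_comm (PowerSeries.rescale _ B), h2,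
      h3, pow_add _ (n.choose 2), map_mul]
    ring

/-- By `choose_two_add` the powers of `q` in degree `l + 1` combine into the single factor
`q^(-l(l+1)/2)`. What remains is the convolution of `1 - φ` with `c`, equal to `q^l c_l` by the
functional equation. -/
theorem coeff_sum_qPower_denom {q : ℝ} (hq0 : 0 < q) (hq1 : q < 1) {φ : ℝ⟦X⟧}
    (hφ0 : PowerSeries.constantCoeff φ = 0) {k M : ℕ} (hk : k ≤ M) :
    PowerSeries.coeff k (∑ n ∈ Finset.Icc 1 M,
      PowerSeries.C (PowerSeries.coeff n (PowerSeries.X * (1 - φ))) *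
        (PowerSeries.C ((q⁻¹) ^ n.choose 2) * PowerSeries.X ^ n *
          PowerSeries.rescale ((q⁻¹) ^ n) (denomSeries q φ))) =
      PowerSeries.coeff k (PowerSeries.X * denomSeries q φ) := by
  have hterm : ∀ n, PowerSeries.coeff k
      (PowerSeries.C (PowerSeries.coeff n (PowerSeries.X * (1 - φ))) *
        (PowerSeries.C ((q⁻¹) ^ n.choose 2) * PowerSeries.X ^ n *
          PowerSeries.rescale ((q⁻¹) ^ n) (denomSeries q φ))) =
      if n ≤ k then PowerSeries.coeff n (PowerSeries.X * (1 - φ)) *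
        ((q⁻¹) ^ n.choose 2 * (((q⁻¹) ^ n) ^ (k - n) *
          ((q⁻¹) ^ (k - n).choose 2 * prodCoeff q φ (k - n)))) else 0 := by
    intro n
    rw [PowerSeries.coeff_C_mul, mul_assoc (PowerSeries.C _), PowerSeries.coeff_C_mul,
      PowerSeries.coeff_X_pow_mul', PowerSeries.coeff_rescale, denomSeries,
      PowerSeries.coeff_mk]
    split_ifs <;> simp
  rw [map_sum, Finset.sum_congr rfl fun n _ => hterm n]
  cases k with
  | zero =>
    rw [PowerSeries.coeff_zero_X_mul]
    refine Finset.sum_eq_zero fun n hn => ?_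
    rw [Finset.mem_Icc] at hn
    rw [if_neg (by omega)]
  | succ l =>
    rw [← Finset.sum_filter]
    have hset : (Finset.Icc 1 M).filter (· ≤ l + 1) = (Finset.range (l + 1)).image (· + 1) := by
      ext n
      simp only [Finset.mem_filter, Finset.mem_Icc, Finset.mem_image, Finset.mem_range]
      constructor
      · rintro ⟨h1, h2⟩
        exact ⟨n - 1, by omega, by omega⟩
      · rintro ⟨j, h1, rfl⟩
        omega
    rw [hset, Finset.sum_image (fun a _ b _ h => by simpa using h),
      PowerSeries.coeff_succ_X_mul, denomSeries, PowerSeries.coeff_mk]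
    have hc := congrArg (PowerSeries.coeff l) (one_sub_mul_mk_prodCoeff hq0 hq1 hφ0)
    rw [PowerSeries.coeff_rescale, PowerSeries.coeff_mk, PowerSeries.coeff_mul,
      Finset.Nat.sum_antidiagonal_eq_sum_range_succ
      (fun i j => PowerSeries.coeff i (1 - φ) *
        PowerSeries.coeff j (PowerSeries.mk (prodCoeff q φ)))] at hc
    have hsum : ∀ j ∈ Finset.range (l + 1),
        PowerSeries.coeff (j + 1) (PowerSeries.X * (1 - φ)) *
        ((q⁻¹) ^ (j + 1).choose 2 * (((q⁻¹) ^ (j + 1)) ^ (l + 1 - (j + 1)) *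
          ((q⁻¹) ^ (l + 1 - (j + 1)).choose 2 * prodCoeff q φ (l + 1 - (j + 1))))) =
        (q⁻¹) ^ (l + 1).choose 2 * (PowerSeries.coeff j (1 - φ) *
          PowerSeries.coeff (l - j) (PowerSeries.mk (prodCoeff q φ))) := by
      intro j hj
      rw [Finset.mem_range] at hj
      obtain ⟨i, rfl⟩ : ∃ i, l = j + i := ⟨l - j, by omega⟩
      rw [PowerSeries.coeff_succ_X_mul, show j + i + 1 - (j + 1) = i by omega,
        show j + i - j = i by omega, show j + i + 1 = (j + 1) + i by ring, choose_two_add (j + 1) i,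
        PowerSeries.coeff_mk, ← pow_mul, pow_add, pow_add]
      ring
    rw [Finset.sum_congr rfl hsum, ← Finset.mul_sum, hc, choose_two_add l 1]
    have : q⁻¹ ^ l * q ^ l = 1 := by
      rw [← mul_pow, inv_mul_cancel₀ hq0.ne', one_pow]
    simp only [pow_add]
    simp
    linear_combination ((q ^ l.choose 2)⁻¹ * prodCoeff q φ l) * (by simpa using this : (q ^ l)⁻¹ * q ^ l = 1)

theorem isRightInverse_denomSeries {q : ℝ} (hq0 : 0 < q) (hq1 : q < 1) {φ : ℝ⟦X⟧}
    (hφ0 : PowerSeries.constantCoeff φ = 0) {g : ℝ⟦X⟧}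
    (h : g * denomSeries q φ = PowerSeries.X * PowerSeries.rescale q⁻¹ (denomSeries q φ)) :
    IsRightInverse q (PowerSeries.X * (1 - φ)) g := by
  refine ⟨?_, fun m => ?_⟩
  · have := congrArg PowerSeries.constantCoeff h
    simpa [constantCoeff_denomSeries] using this
  set S : ℝ⟦X⟧ := ∑ n ∈ Finset.Icc 1 m,
    PowerSeries.C (PowerSeries.coeff n (PowerSeries.X * (1 - φ))) * qPower q g n with hS
  have hSm : PowerSeries.coeff m S = ∑ n ∈ Finset.Icc 1 m,
      PowerSeries.coeff n (PowerSeries.X * (1 - φ)) * PowerSeries.coeff m (qPower q g n) := by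
    rw [hS, map_sum]
    exact Finset.sum_congr rfl fun n _ => PowerSeries.coeff_C_mul _ _ _
  -- The defining sum is truncated at `m`, so equality with `X` is only available modulo `X^(m+1)`;
  -- the unit `B` is then cancelled.
  have hdvd : (PowerSeries.X : ℝ⟦X⟧) ^ (m + 1) ∣ (S - PowerSeries.X) * denomSeries q φ := by
    rw [PowerSeries.X_pow_dvd_iff]
    intro k hk
    rw [sub_mul, map_sub, sub_eq_zero, ← coeff_sum_qPower_denom hq0 hq1 hφ0 (Nat.lt_succ_iff.mp hk),
      hS, Finset.sum_mul]
    refine congrArg _ (Finset.sum_congr rfl fun n _ => ?_)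
    rw [mul_assoc, qPower_mul_denom q h]
  have hunit : IsUnit (denomSeries q φ) := by
    rw [PowerSeries.isUnit_iff_constantCoeff, constantCoeff_denomSeries]
    exact isUnit_one
  have h2 := PowerSeries.X_pow_dvd_iff.mp (hunit.dvd_mul_right.mp hdvd) m (Nat.lt_succ_self m)
  rw [map_sub, sub_eq_zero] at h2
  rw [← hSm, h2]

theorem IsRightInverse.mul_denomSeries {q : ℝ} (hq0 : 0 < q) (hq1 : q < 1) {φ g : ℝ⟦X⟧}
    (hφ0 : PowerSeries.constantCoeff φ = 0)
    (hg : IsRightInverse q (PowerSeries.X * (1 - φ)) g) :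
    g * denomSeries q φ = PowerSeries.X * PowerSeries.rescale q⁻¹ (denomSeries q φ) := by
  have hB : PowerSeries.constantCoeff (denomSeries q φ) ≠ 0 := by
    rw [constantCoeff_denomSeries]; exact one_ne_zero
  have h : PowerSeries.X * PowerSeries.rescale q⁻¹ (denomSeries q φ) * (denomSeries q φ)⁻¹ *
      denomSeries q φ = PowerSeries.X * PowerSeries.rescale q⁻¹ (denomSeries q φ) := by
    rw [mul_assoc, PowerSeries.inv_mul_cancel _ hB, mul_one]
  rw [hg.unique ?_ (isRightInverse_denomSeries hq0 hq1 hφ0 h), h]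
  rw [← zero_add 1, PowerSeries.coeff_succ_X_mul]
  simp [hφ0]

/-! ### Convergence of `φ` -/

/-- The growth condition gives `φ_n ≤ n^(-n)` eventually, hence `φ_n r^n ≤ (r/n)^n ≤ 2^(-n)` once `n
≥ 2r`. -/
theorem summable_coeff_mul_pow {φ : ℝ⟦X⟧} (hφ : ∀ n : ℕ, 0 ≤ PowerSeries.coeff n φ)
    (hlim : limsup (logRatio φ) atTop < ((-2 : ℝ) : EReal)) {r : ℝ} (hr : 0 ≤ r) :
    Summable fun n => PowerSeries.coeff n φ * r ^ n := by
  have h1 := eventually_lt_of_limsup_lt hlim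
  have h2 : ∀ᶠ n : ℕ in atTop, PowerSeries.coeff n φ * r ^ n ≤ (1 / 2 : ℝ) ^ n := by
    filter_upwards [h1, eventually_ge_atTop 2, eventually_ge_atTop ⌈2 * r⌉₊] with n hn hn2 hnr
    have hnr' : 2 * r ≤ n := Nat.ceil_le.mp hnr
    have hn0 : (2 : ℝ) ≤ n := by exact_mod_cast hn2
    have hlog : 0 < Real.log n := Real.log_pos (by linarith)
    have hφn : PowerSeries.coeff n φ ≤ ((n : ℝ)⁻¹) ^ n := by
      rcases (hφ n).eq_or_lt with h0 | hpos
      · rw [← h0]; positivity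
      rw [logRatio, EReal.div_lt_iff (by exact_mod_cast (by positivity)) (EReal.coe_ne_top _),
        ENNReal.log_ofReal_of_pos hpos, ← EReal.coe_mul, EReal.coe_lt_coe_iff] at hn
      have h3 : Real.log (PowerSeries.coeff n φ) ≤ n * -Real.log n := by
        have : 0 < n * Real.log n := by positivity
        linarith
      rw [← Real.log_inv, ← Real.log_pow] at h3
      exact (Real.log_le_log_iff hpos (by positivity)).mp h3
    calc PowerSeries.coeff n φ * r ^ n ≤ ((n : ℝ)⁻¹) ^ n * r ^ n := by gcongr
      _ = (r / n) ^ n := by rw [← mul_pow]; ring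
      _ ≤ (1 / 2 : ℝ) ^ n := by
        refine pow_le_pow_left₀ (by positivity) ?_ n
        rw [div_le_iff₀ (by linarith)]
        linarith
  refine summable_of_isBigO_nat (summable_geometric_of_lt_one (by norm_num) one_half_lt_one) ?_
  refine Asymptotics.IsBigO.of_bound 1 (h2.mono fun n hn => ?_)
  rw [one_mul, Real.norm_of_nonneg (mul_nonneg (hφ n) (by positivity)),
    Real.norm_of_nonneg (by positivity)]
  exact hn

theorem summable_norm_toFun {φ : ℝ⟦X⟧} (hφ : ∀ n : ℕ, 0 ≤ PowerSeries.coeff n φ)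
    (hsum : ∀ r : ℝ, 0 ≤ r → Summable fun n => PowerSeries.coeff n φ * r ^ n) (z : ℂ) :
    Summable fun n : ℕ => ‖((PowerSeries.coeff n φ : ℝ) : ℂ) * z ^ n‖ := by
  refine (hsum ‖z‖ (norm_nonneg z)).congr fun n => ?_
  rw [norm_mul, norm_pow, Complex.norm_real, Real.norm_of_nonneg (hφ n)]

theorem differentiable_toFun {φ : ℝ⟦X⟧} (hφ : ∀ n : ℕ, 0 ≤ PowerSeries.coeff n φ)
    (hsum : ∀ r : ℝ, 0 ≤ r → Summable fun n => PowerSeries.coeff n φ * r ^ n) :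
    Differentiable ℂ (toFun φ) := by
  intro z
  have h : DifferentiableOn ℂ (toFun φ) (Metric.ball 0 (‖z‖ + 1)) := by
    refine Complex.differentiableOn_tsum_of_summable_norm (hsum (‖z‖ + 1) (by positivity))
      (fun n => by fun_prop) Metric.isOpen_ball fun n w hw => ?_
    rw [mem_ball_zero_iff] at hw
    rw [norm_mul, norm_pow, Complex.norm_real, Real.norm_of_nonneg (hφ n)]
    have := hφ n
    gcongr
  exact h.differentiableAt (Metric.isOpen_ball.mem_nhds (by simp))

/-! ### Coefficients of `1 / (1 - φ)` -/

theorem eq_of_hasSum_pow {s t : ℕ → ℂ} {f : ℂ → ℂ} {r : ℝ} (hr : 0 < r)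
    (hs : ∀ z : ℂ, ‖z‖ < r → HasSum (fun n => s n * z ^ n) (f z))
    (ht : ∀ z : ℂ, ‖z‖ < r → HasSum (fun n => t n * z ^ n) (f z)) : s = t := by
  have hd : ∀ z : ℂ, ‖z‖ < r → HasSum (fun n => (s - t) n * z ^ n) 0 := fun z hz => by
    simpa [sub_mul] using (hs z hz).sub (ht z hz)
  -- At a point strictly inside the disk the terms tend to zero, which bounds the radius of
  -- convergence from below.
  obtain ⟨ρ, hρr⟩ : ∃ ρ : NNReal, (ρ : ℝ) = r / 2 := ⟨⟨r / 2, by positivity⟩, rfl⟩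
  have hρ0 : 0 < ρ := by rw [← NNReal.coe_pos, hρr]; positivity
  have hrad : (ρ : ENNReal) ≤ (FormalMultilinearSeries.ofScalars ℂ (s - t)).radius := by
    refine FormalMultilinearSeries.le_radius_of_tendsto _ (l := 0) ?_
    have h1 := (hd ((ρ : ℝ) : ℂ) ((Complex.norm_of_nonneg ρ.coe_nonneg).trans_lt
      (by linarith))).summable.tendsto_atTop_zero.norm
    simpa [FormalMultilinearSeries.ofScalars_norm] using h1
  have hfps : HasFPowerSeriesOnBall (0 : ℂ → ℂ)
      (FormalMultilinearSeries.ofScalars ℂ (s - t)) 0 ρ := by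
    refine ⟨hrad, by exact_mod_cast hρ0, fun {y} hy => ?_⟩
    simp only [FormalMultilinearSeries.ofScalars_apply_eq, smul_eq_mul, Pi.zero_apply]
    refine hd y ?_
    rw [Metric.mem_eball, edist_zero_right, ← ofReal_norm,
      ENNReal.ofReal_lt_coe_iff (norm_nonneg y)] at hy
    linarith
  have h2 := hfps.hasFPowerSeriesAt.eq_zero
  rw [FormalMultilinearSeries.ofScalars_series_eq_zero] at h2
  exact sub_eq_zero.mp h2

/-- By compactness the closed disk can be thickened inside the open set where `h ≠ 0`. The larger
radius makes the Taylor series of `1 / h` converge on the circle `‖z‖ = r` too. -/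
theorem exists_differentiableOn_inv_closedBall {h : ℂ → ℂ} (hd : Differentiable ℂ h) {r : ℝ}
    (hr : 0 < r) (hne : ∀ z : ℂ, ‖z‖ ≤ r → h z ≠ 0) :
    ∃ R, r < R ∧ (∀ z : ℂ, ‖z‖ ≤ R → h z ≠ 0) ∧
      DifferentiableOn ℂ (fun z => (h z)⁻¹) (Metric.closedBall 0 R) := by
  have hopen : IsOpen {z | h z ≠ 0} := isOpen_ne_fun hd.continuous continuous_const
  obtain ⟨δ, hδ, hsub⟩ := (isCompact_closedBall (0 : ℂ) r).exists_cthickening_subset_open hopen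
    fun z hz => hne z (by simpa using hz)
  rw [cthickening_closedBall hδ.le hr.le] at hsub
  refine ⟨δ + r, by linarith, fun z hz => hsub (by simpa using hz), ?_⟩
  exact hd.differentiableOn.fun_inv fun z hz => hsub hz

/-- Write `1 - φ(z) = (ζ - z) D(z)` with `D` the divided difference at `ζ`. If `1 / D = ∑ a_n z^n`
and `1 / (1 - φ) = ∑ u_n z^n`, then `a_n = ζ u_n - u_(n-1)`, so the partial sums of `∑ a_k ζ^k`
telescope to `ζ^(n+1) u_n`. They converge to `1 / D(ζ) = 1 / φ'(ζ)`. -/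
theorem tendsto_pow_mul_coeff_inv {φ : ℝ⟦X⟧} (hφ0 : PowerSeries.constantCoeff φ = 0)
    (hφ : ∀ n : ℕ, 0 ≤ PowerSeries.coeff n φ)
    (hsum : ∀ r : ℝ, 0 ≤ r → Summable fun n => PowerSeries.coeff n φ * r ^ n)
    {ζ : ℝ} (hζ : 0 < ζ) (hφζ : toFun φ ζ = 1)
    (hne : ∀ z : ℂ, ‖z‖ ≤ ζ → dslope (toFun φ) ζ z ≠ 0) :
    Tendsto (fun n : ℕ => ((ζ ^ (n + 1) * PowerSeries.coeff n (1 - φ)⁻¹ : ℝ) : ℂ)) atTop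
      (𝓝 (deriv (toFun φ) ζ)⁻¹) := by
  have hΦ := differentiable_toFun hφ hsum
  have hD : Differentiable ℂ (dslope (toFun φ) (ζ : ℂ)) := by
    rw [← differentiableOn_univ] at hΦ ⊢
    exact (Complex.differentiableOn_dslope univ_mem).mpr hΦ
  obtain ⟨R, hR, hneR, hF⟩ := exists_differentiableOn_inv_closedBall hD hζ hne
  have hR0 : 0 < R := hζ.trans hR
  lift R to NNReal using hR0.le
  have hps := hF.hasFPowerSeriesOnBall (by exact_mod_cast hR0)
  set p := cauchyPowerSeries (fun z => (dslope (toFun φ) (ζ : ℂ) z)⁻¹) 0 R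
  set a : ℕ → ℂ := p.coeff with ha
  have hball : ∀ z : ℂ, ‖z‖ < R → z ∈ Metric.eball (0 : ℂ) R := fun z hz => by
    rw [Metric.mem_eball, edist_zero_right, ← ofReal_norm,
      ENNReal.ofReal_lt_coe_iff (norm_nonneg z)]
    exact hz
  have hasum : ∀ z : ℂ, ‖z‖ < R →
      HasSum (fun n => a n * z ^ n) (dslope (toFun φ) (ζ : ℂ) z)⁻¹ := fun z hz => by
    have := hps.hasSum (hball z hz)
    simpa only [FormalMultilinearSeries.apply_eq_pow_smul_coeff, smul_eq_mul, zero_add,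
      mul_comm (z ^ _)] using this
  have hanorm : ∀ z : ℂ, ‖z‖ < R → Summable (fun n => ‖a n * z ^ n‖) := fun z hz => by
    have := p.summable_norm_apply (x := z) (Metric.eball_subset_eball hps.r_le (hball z hz))
    simpa only [FormalMultilinearSeries.apply_eq_pow_smul_coeff, smul_eq_mul,
      mul_comm (z ^ _)] using this
  set A : ℂ⟦X⟧ := PowerSeries.mk a with hA
  set N : ℂ⟦X⟧ := PowerSeries.map Complex.ofRealHom (1 - φ) with hN
  have hNsum : ∀ z : ℂ, Summable (fun n => ‖PowerSeries.coeff n N * z ^ n‖) ∧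
      HasSum (fun n => PowerSeries.coeff n N * z ^ n) (1 - toFun φ z) := fun z => by
    have h1 : HasSum (fun n => PowerSeries.coeff n (1 : ℂ⟦X⟧) * z ^ n) 1 := by
      have := hasSum_single (f := fun n => PowerSeries.coeff n (1 : ℂ⟦X⟧) * z ^ n) 0
        (fun n hn => by simp [PowerSeries.coeff_one, hn])
      simpa using this
    have h2 := summable_norm_toFun hφ hsum z
    have h3 : (fun n => PowerSeries.coeff n N * z ^ n) = fun n =>
        PowerSeries.coeff n (1 : ℂ⟦X⟧) * z ^ n - ((PowerSeries.coeff n φ : ℝ) : ℂ) * z ^ n := by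
      funext n
      rw [hN, map_sub, map_one, map_sub, PowerSeries.coeff_map, sub_mul]
      rfl
    have h4 : HasSum (fun n => PowerSeries.coeff n N * z ^ n) (1 - toFun φ z) := by
      rw [h3]
      exact h1.sub h2.of_norm.hasSum
    exact ⟨h4.summable.norm, h4⟩
  have hNA : N * A = PowerSeries.C (ζ : ℂ) - PowerSeries.X := by
    have key : (fun n => PowerSeries.coeff n (N * A)) =
        fun n => PowerSeries.coeff n (PowerSeries.C (ζ : ℂ) - PowerSeries.X) := by
      refine eq_of_hasSum_pow (f := fun z => (ζ : ℂ) - z) hR0 (fun z hz => ?_) (fun z _ => ?_)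
      · have h1 := hasSum_sum_range_mul_of_summable_norm (hNsum z).1 (hanorm z hz)
        rw [(hNsum z).2.tsum_eq, (hasum z hz).tsum_eq] at h1
        have h2 : (1 - toFun φ z) = (ζ - z) * dslope (toFun φ) (ζ : ℂ) z := by
          have := sub_smul_dslope (toFun φ) (ζ : ℂ) z
          rw [hφζ, smul_eq_mul] at this
          linear_combination this
        rw [h2, mul_inv_cancel_right₀ (hneR z hz.le)] at h1
        suffices h3 : (fun n => PowerSeries.coeff n (N * A) * z ^ n) = fun n =>
            ∑ k ∈ Finset.range (n + 1),
              PowerSeries.coeff k N * z ^ k * (a (n - k) * z ^ (n - k)) by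
          rw [h3]; exact h1
        funext n
        rw [PowerSeries.coeff_mul, Finset.Nat.sum_antidiagonal_eq_sum_range_succ
          (fun i j => PowerSeries.coeff i N * PowerSeries.coeff j A), Finset.sum_mul]
        refine Finset.sum_congr rfl fun k hk => ?_
        rw [hA, PowerSeries.coeff_mk, mul_mul_mul_comm, ← pow_add,
          Nat.add_sub_cancel' (Nat.lt_succ_iff.mp (Finset.mem_range.mp hk))]
      · have h5 := hasSum_sum_of_ne_finset_zero (L := .unconditional ℕ) (f := fun n =>
          PowerSeries.coeff n (PowerSeries.C (ζ : ℂ) - PowerSeries.X) * z ^ n)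
          (s := Finset.range 2) (fun n hn => by
            simp only [Finset.mem_range, not_lt] at hn
            rw [map_sub, PowerSeries.coeff_C, PowerSeries.coeff_X, if_neg (by omega),
              if_neg (by omega)]
            simp)
        simpa [Finset.sum_range_succ, PowerSeries.coeff_X, PowerSeries.coeff_C, sub_eq_add_neg]
          using h5
    ext n
    exact congrFun key n
  have hφ1 : PowerSeries.constantCoeff (1 - φ) ≠ 0 := by simp [hφ0]
  set U : ℂ⟦X⟧ := PowerSeries.map Complex.ofRealHom (1 - φ)⁻¹ with hU
  have hUN : U * N = 1 := by
    rw [hU, hN, ← map_mul, PowerSeries.inv_mul_cancel _ hφ1, map_one]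
  have hAU : A = PowerSeries.C (ζ : ℂ) * U - U * PowerSeries.X := by
    calc A = U * (N * A) := by rw [← mul_assoc, hUN, one_mul]
      _ = _ := by rw [hNA]; ring
  have hpartial : ∀ n : ℕ, ∑ k ∈ Finset.range (n + 1), a k * (ζ : ℂ) ^ k =
      (ζ : ℂ) ^ (n + 1) * PowerSeries.coeff n U := by
    have hak : ∀ k, a k = PowerSeries.coeff k A := fun k => by rw [hA, PowerSeries.coeff_mk]
    intro n
    induction n with
    | zero =>
      rw [Finset.sum_range_one, hak, hAU]
      simp
    | succ n ih =>
      rw [Finset.sum_range_succ, ih, hak, hAU, map_sub, PowerSeries.coeff_C_mul,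
        PowerSeries.coeff_succ_mul_X]
      ring
  have hlim := ((hasum ζ (by
    rwa [Complex.norm_real, Real.norm_of_nonneg hζ.le])).tendsto_sum_nat.comp
      (tendsto_add_atTop_nat 1))
  rw [dslope_same] at hlim
  refine hlim.congr fun n => ?_
  rw [Function.comp_apply, hpartial, hU, PowerSeries.coeff_map]
  simp

/-! ### Asymptotics of the coefficients of the product -/

section ProdCoeff

variable {q : ℝ} {φ : ℝ⟦X⟧} {ζ : ℝ}

theorem prodCoeff_nonneg (hq0 : 0 < q) (hq1 : q < 1) (hφ : ∀ n : ℕ, 0 ≤ PowerSeries.coeff n φ)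
    (n : ℕ) : 0 ≤ prodCoeff q φ n := by
  induction n using Nat.strong_induction_on with
  | _ n ih =>
    cases n with
    | zero => rw [prodCoeff_zero]; exact zero_le_one
    | succ n =>
      have h : 0 < 1 - q ^ (n + 1) := sub_pos.mpr (pow_lt_one₀ hq0.le hq1 (by simp))
      refine nonneg_of_mul_nonneg_left ?_ h
      rw [prodCoeff_mul hq0 hq1]
      exact Finset.sum_nonneg fun k hk => mul_nonneg (hφ _) (ih k (Finset.mem_range.mp hk))

/-- Since `∑ φ_n ζ^n = 1`, the recursion bounds `c_n ζ^n (1 - q^n)` by the largest earlier `c_k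
ζ^k`, and the product of the `1 / (1 - q^j)` converges. -/
theorem exists_prodCoeff_mul_pow_le (hq0 : 0 < q) (hq1 : q < 1)
    (hφ : ∀ n : ℕ, 0 ≤ PowerSeries.coeff n φ) (hζ : 0 < ζ)
    (hsum : HasSum (fun n => PowerSeries.coeff n φ * ζ ^ n) 1) :
    ∃ M, ∀ n, prodCoeff q φ n * ζ ^ n ≤ M := by
  -- The factors are `1 / (1 - q^(j+1))`, written as `1 + x` for the later use of `1 + x ≤ exp x`.
  set W : ℕ → ℝ := fun m => ∏ j ∈ Finset.range m, (1 + q ^ (j + 1) / (1 - q ^ (j + 1))) with hW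
  have hpos : ∀ j : ℕ, 0 < 1 - q ^ (j + 1) := fun j =>
    sub_pos.mpr (pow_lt_one₀ hq0.le hq1 (by simp))
  have hW1 : ∀ j : ℕ, (1 : ℝ) ≤ 1 + q ^ (j + 1) / (1 - q ^ (j + 1)) := fun j => by
    have := hpos j
    have : 0 ≤ q ^ (j + 1) / (1 - q ^ (j + 1)) := by positivity
    linarith
  have hWnn : ∀ m, 0 ≤ W m := fun m =>
    Finset.prod_nonneg fun j _ => zero_le_one.trans (hW1 j)
  have hWmono : Monotone W := monotone_nat_of_le_succ fun m => by
    rw [hW]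
    simp only
    rw [Finset.prod_range_succ]
    exact le_mul_of_one_le_right (hWnn m) (hW1 m)
  have hle : ∀ n, prodCoeff q φ n * ζ ^ n ≤ W n := by
    intro n
    induction n using Nat.strong_induction_on with
    | _ n ih =>
      cases n with
      | zero => simp [hW, prodCoeff_zero]
      | succ n =>
        have hp := hpos n
        have hterm : ∀ k ∈ Finset.range (n + 1),
            PowerSeries.coeff (n + 1 - k) φ * prodCoeff q φ k * ζ ^ (n + 1) ≤
              PowerSeries.coeff (n + 1 - k) φ * ζ ^ (n + 1 - k) * W n := by
          intro k hk
          have hk' := Finset.mem_range.mp hk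
          have h1 : ζ ^ (n + 1) = ζ ^ (n + 1 - k) * ζ ^ k := by
            rw [← pow_add]; congr 1; omega
          have h2 : prodCoeff q φ k * ζ ^ k ≤ W n :=
            (ih k hk').trans (hWmono (Nat.lt_succ_iff.mp hk'))
          have h3 : 0 ≤ PowerSeries.coeff (n + 1 - k) φ * ζ ^ (n + 1 - k) :=
            mul_nonneg (hφ _) (by positivity)
          calc PowerSeries.coeff (n + 1 - k) φ * prodCoeff q φ k * ζ ^ (n + 1)
              = PowerSeries.coeff (n + 1 - k) φ * ζ ^ (n + 1 - k) *
                (prodCoeff q φ k * ζ ^ k) := by rw [h1]; ring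
            _ ≤ _ := mul_le_mul_of_nonneg_left h2 h3
        have hp1 : ∑ k ∈ Finset.range (n + 1),
            PowerSeries.coeff (n + 1 - k) φ * ζ ^ (n + 1 - k) ≤ 1 := by
          have h4 := Finset.sum_range_reflect
            (fun k => PowerSeries.coeff (k + 1) φ * ζ ^ (k + 1)) (n + 1)
          have h5 : ∑ k ∈ Finset.range (n + 1),
              PowerSeries.coeff (n + 1 - k) φ * ζ ^ (n + 1 - k) =
              ∑ k ∈ Finset.range (n + 1), PowerSeries.coeff (k + 1) φ * ζ ^ (k + 1) := by
            rw [← h4]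
            refine Finset.sum_congr rfl fun k hk => ?_
            have := Finset.mem_range.mp hk
            rw [show n + 1 - 1 - k + 1 = n + 1 - k by omega]
          have h6 := sum_le_hasSum (Finset.range (n + 2))
            (fun k _ => mul_nonneg (hφ k) (by positivity)) hsum
          rw [Finset.sum_range_succ'] at h6
          have h7 : 0 ≤ PowerSeries.coeff 0 φ * ζ ^ 0 := mul_nonneg (hφ 0) (by positivity)
          rw [h5]
          linarith
        have hmain : prodCoeff q φ (n + 1) * ζ ^ (n + 1) * (1 - q ^ (n + 1)) ≤ W n := by
          rw [mul_right_comm, prodCoeff_mul hq0 hq1, Finset.sum_mul]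
          refine (Finset.sum_le_sum hterm).trans ?_
          rw [← Finset.sum_mul]
          exact mul_le_of_le_one_left (hWnn n) hp1
        have hWs : W (n + 1) = W n / (1 - q ^ (n + 1)) := by
          rw [hW]
          simp only
          rw [Finset.prod_range_succ]
          field_simp
          ring
        rw [hWs, le_div_iff₀ hp]
        exact hmain
  have hgs : Summable fun j : ℕ => q ^ (j + 1) / (1 - q) := by
    refine Summable.div_const ?_ _
    exact (summable_nat_add_iff 1).mpr (summable_geometric_of_lt_one hq0.le hq1)
  refine ⟨Real.exp (∑' j : ℕ, q ^ (j + 1) / (1 - q)), fun n => (hle n).trans ?_⟩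
  calc W n ≤ ∏ j ∈ Finset.range n, Real.exp (q ^ (j + 1) / (1 - q)) := by
        refine Finset.prod_le_prod (fun j _ => zero_le_one.trans (hW1 j)) fun j _ => ?_
        have h1 : q ^ (j + 1) / (1 - q ^ (j + 1)) ≤ q ^ (j + 1) / (1 - q) := by
          have : q ^ (j + 1) ≤ q := pow_le_of_le_one hq0.le hq1.le (by simp)
          have : 0 < 1 - q := by linarith
          gcongr
        have h2 := Real.add_one_le_exp (q ^ (j + 1) / (1 - q))
        linarith
    _ = Real.exp (∑ j ∈ Finset.range n, q ^ (j + 1) / (1 - q)) := (Real.exp_sum _ _).symm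
    _ ≤ _ := Real.exp_le_exp.mpr (hgs.sum_le_tsum _ fun j _ => by
        have : 0 < 1 - q := by linarith
        positivity)

theorem tendsto_prodCoeff_mul_pow (hq0 : 0 < q) (hq1 : q < 1)
    (hφ0 : PowerSeries.constantCoeff φ = 0) {M : ℝ}
    (hM : ∀ n, |prodCoeff q φ n * ζ ^ n| ≤ M) {κ : ℝ}
    (hκ : Tendsto (fun n : ℕ => ζ ^ (n + 1) * PowerSeries.coeff n (1 - φ)⁻¹) atTop (𝓝 κ)) :
    Tendsto (fun n => ζ * (prodCoeff q φ n * ζ ^ n)) atTop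
      (𝓝 (κ * ∑' k, prodCoeff q φ k * ζ ^ k * q ^ k)) := by
  have hφ1 : PowerSeries.constantCoeff (1 - φ) ≠ 0 := by simp [hφ0]
  obtain ⟨V, hV⟩ := hκ.abs.bddAbove_range
  have hV' : ∀ n : ℕ, |ζ ^ (n + 1) * PowerSeries.coeff n (1 - φ)⁻¹| ≤ V := fun n => hV ⟨n, rfl⟩
  have hV0 : 0 ≤ V := (abs_nonneg _).trans (hV' 0)
  have hM0 : 0 ≤ M := (abs_nonneg _).trans (hM 0)
  have hC : PowerSeries.mk (prodCoeff q φ) =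
      PowerSeries.rescale q (PowerSeries.mk (prodCoeff q φ)) * (1 - φ)⁻¹ := by
    rw [← one_sub_mul_mk_prodCoeff hq0 hq1 hφ0, mul_right_comm, PowerSeries.mul_inv_cancel _ hφ1,
      one_mul]
  -- The Cauchy product of `C(qz)` and `1 / (1 - φ)`, extended by zero to all `k` so that dominated
  -- convergence applies.
  set F : ℕ → ℕ → ℝ := fun n k => if k ≤ n then
    ζ ^ (n - k + 1) * PowerSeries.coeff (n - k) (1 - φ)⁻¹ * (prodCoeff q φ k * ζ ^ k * q ^ k)
    else 0 with hF
  have hsum : ∀ n, ζ * (prodCoeff q φ n * ζ ^ n) = ∑' k, F n k := by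
    intro n
    have h1 := congrArg (PowerSeries.coeff n) hC
    rw [PowerSeries.coeff_mk, PowerSeries.coeff_mul,
      Finset.Nat.sum_antidiagonal_eq_sum_range_succ (fun i j =>
        PowerSeries.coeff i (PowerSeries.rescale q (PowerSeries.mk (prodCoeff q φ))) *
          PowerSeries.coeff j (1 - φ)⁻¹)] at h1
    rw [tsum_eq_sum (s := Finset.range (n + 1)) (fun k hk => by
      rw [Finset.mem_range, not_lt] at hk
      rw [hF]
      exact if_neg (by omega)), h1, Finset.sum_mul, Finset.mul_sum]
    refine Finset.sum_congr rfl fun k hk => ?_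
    have hk' : k ≤ n := Nat.lt_succ_iff.mp (Finset.mem_range.mp hk)
    have h2 : ζ ^ n = ζ ^ (n - k) * ζ ^ k := by rw [← pow_add, Nat.sub_add_cancel hk']
    simp only [hF, if_pos hk', PowerSeries.coeff_rescale, PowerSeries.coeff_mk]
    rw [h2, pow_succ]
    ring
  simp only [hsum]
  rw [← tsum_mul_left]
  refine tendsto_tsum_of_dominated_convergence (bound := fun k => V * (M * q ^ k))
    (((summable_geometric_of_lt_one hq0.le hq1).mul_left M).mul_left V) (fun k => ?_)
    (Eventually.of_forall fun n k => ?_)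
  · have h3 := (hκ.comp (tendsto_sub_atTop_nat k)).mul_const (prodCoeff q φ k * ζ ^ k * q ^ k)
    refine h3.congr' ?_
    filter_upwards [eventually_ge_atTop k] with n hn
    simp only [hF, if_pos hn, Function.comp_apply]
  · simp only [hF]
    split_ifs with hkn
    · rw [Real.norm_eq_abs, abs_mul, abs_mul _ (q ^ k), abs_of_pos (pow_pos hq0 k)]
      exact mul_le_mul (hV' _) (mul_le_mul_of_nonneg_right (hM k) (by positivity))
        (by positivity) hV0
    · rw [norm_zero]; positivity

/-- This is `C(z) (1 - φ(z)) = C(qz)` at `z = ζ y`. The condition `y < 1` ensures convergence, as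
`c_k ζ^k` is merely bounded. -/
theorem tsum_prodCoeff_functional (hq0 : 0 < q) (hq1 : q < 1)
    (hφ0 : PowerSeries.constantCoeff φ = 0)
    (hsum : ∀ r : ℝ, 0 ≤ r → Summable fun n => PowerSeries.coeff n φ * r ^ n)
    (hζ : 0 < ζ) {M : ℝ} (hM : ∀ n, |prodCoeff q φ n * ζ ^ n| ≤ M) {y : ℝ} (hy0 : 0 ≤ y)
    (hy1 : y < 1) :
    (∑' k, prodCoeff q φ k * ζ ^ k * y ^ k) * (1 - ∑' n, PowerSeries.coeff n φ * (ζ * y) ^ n) =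
      ∑' k, prodCoeff q φ k * ζ ^ k * (q * y) ^ k := by
  have hN : HasSum (fun n => PowerSeries.coeff n (1 - φ) * (ζ * y) ^ n)
      (1 - ∑' n, PowerSeries.coeff n φ * (ζ * y) ^ n) := by
    have h1 : HasSum (fun n => PowerSeries.coeff n (1 : ℝ⟦X⟧) * (ζ * y) ^ n) 1 := by
      have := hasSum_single (f := fun n => PowerSeries.coeff n (1 : ℝ⟦X⟧) * (ζ * y) ^ n) 0
        (fun n hn => by simp [PowerSeries.coeff_one, hn])
      simpa using this
    simpa [sub_mul] using h1.sub (hsum (ζ * y) (by positivity)).hasSum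
  have hD : Summable fun k => ‖prodCoeff q φ k * ζ ^ k * y ^ k‖ := by
    refine Summable.of_nonneg_of_le (fun _ => norm_nonneg _) (fun k => ?_)
      ((summable_geometric_of_lt_one hy0 hy1).mul_left M)
    rw [norm_mul, norm_pow, Real.norm_of_nonneg hy0]
    exact mul_le_mul_of_nonneg_right (hM k) (by positivity)
  rw [← hN.tsum_eq, mul_comm, tsum_mul_tsum_eq_tsum_sum_range_of_summable_norm hN.summable.norm hD]
  refine tsum_congr fun n => ?_
  have h1 := congrArg (PowerSeries.coeff n) (one_sub_mul_mk_prodCoeff hq0 hq1 hφ0)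
  rw [PowerSeries.coeff_rescale, PowerSeries.coeff_mk, PowerSeries.coeff_mul,
    Finset.Nat.sum_antidiagonal_eq_sum_range_succ (fun i j =>
      PowerSeries.coeff i (1 - φ) * PowerSeries.coeff j (PowerSeries.mk (prodCoeff q φ)))] at h1
  rw [mul_pow q, show prodCoeff q φ n * ζ ^ n * (q ^ n * y ^ n) =
    q ^ n * prodCoeff q φ n * (ζ ^ n * y ^ n) by ring, ← h1, Finset.sum_mul]
  refine Finset.sum_congr rfl fun k hk => ?_
  obtain ⟨j, rfl⟩ := Nat.exists_eq_add_of_le (Nat.lt_succ_iff.mp (Finset.mem_range.mp hk))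
  rw [Nat.add_sub_cancel_left, PowerSeries.coeff_mk, mul_pow, pow_add, pow_add]
  ring

/-- The functional equation turns the partial product into `C(ζ q^(n+1))`, which tends to `C(0) =
1`. -/
theorem tendsto_tsum_prodCoeff_mul_prod (hq0 : 0 < q) (hq1 : q < 1)
    (hφ0 : PowerSeries.constantCoeff φ = 0)
    (hsum : ∀ r : ℝ, 0 ≤ r → Summable fun n => PowerSeries.coeff n φ * r ^ n)
    (hζ : 0 < ζ) {M : ℝ} (hM : ∀ n, |prodCoeff q φ n * ζ ^ n| ≤ M) :
    Tendsto (fun n : ℕ => (∑' k, prodCoeff q φ k * ζ ^ k * q ^ k) * ∏ j ∈ Finset.range n,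
      (1 - ∑' n, PowerSeries.coeff n φ * (ζ * q ^ (j + 1)) ^ n)) atTop (𝓝 1) := by
  have hprod : ∀ n : ℕ, (∑' k, prodCoeff q φ k * ζ ^ k * q ^ k) * ∏ j ∈ Finset.range n,
      (1 - ∑' n, PowerSeries.coeff n φ * (ζ * q ^ (j + 1)) ^ n) =
      ∑' k, prodCoeff q φ k * ζ ^ k * (q ^ (n + 1)) ^ k := by
    intro n
    induction n with
    | zero => simp
    | succ n ih =>
      rw [Finset.prod_range_succ, ← mul_assoc, ih, tsum_prodCoeff_functional hq0 hq1 hφ0 hsum hζ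
        hM (by positivity) (pow_lt_one₀ hq0.le hq1 (by simp)), ← pow_succ']
  simp only [hprod]
  have h1 : (∑' k, if k = 0 then (1 : ℝ) else 0) = 1 := by
    simp
  rw [← h1]
  refine tendsto_tsum_of_dominated_convergence (bound := fun k => M * q ^ k)
    ((summable_geometric_of_lt_one hq0.le hq1).mul_left M) (fun k => ?_)
    (Eventually.of_forall fun n k => ?_)
  · rcases eq_or_ne k 0 with rfl | hk
    · simp [prodCoeff_zero]
    · have h2 := (((tendsto_pow_atTop_nhds_zero_of_lt_one hq0.le hq1).comp
        (tendsto_add_atTop_nat 1)).pow k).const_mul (prodCoeff q φ k * ζ ^ k)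
      rw [zero_pow hk, mul_zero] at h2
      simpa [hk] using h2
  · rw [norm_mul, norm_pow, Real.norm_of_nonneg (pow_nonneg hq0.le _)]
    refine mul_le_mul (hM k) (pow_le_pow_left₀ (by positivity)
      (pow_le_of_le_one hq0.le hq1.le (by simp)) k) (by positivity) ((abs_nonneg _).trans (hM 0))

end ProdCoeff

/-! ### Passing to the quotient -/

theorem tendsto_of_perturbed_recursion {q : ℝ} (hq0 : 0 < q) (hq1 : q < 1) {x d : ℕ → ℝ} {M L : ℝ}
    (hM : ∀ n, |d n| ≤ M)
    (hx : ∀ n, x n = d n - ∑ i ∈ Finset.range n, x i * d (n - i) * q ^ ((n - i) * (i + 1)))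
    (hd : Tendsto d atTop (𝓝 L)) : Tendsto x atTop (𝓝 L) := by
  have hM0 : 0 ≤ M := (abs_nonneg _).trans (hM 0)
  have hstep : ∀ n Y, (∀ i < n, |x i| ≤ Y) → |x n - d n| ≤ n * q ^ n * M * Y := by
    intro n Y hY
    rw [hx n, sub_sub_cancel_left, abs_neg]
    refine (Finset.abs_sum_le_sum_abs _ _).trans ?_
    have hterm : ∀ i ∈ Finset.range n,
        |x i * d (n - i) * q ^ ((n - i) * (i + 1))| ≤ Y * M * q ^ n := by
      intro i hi
      have hi' := Finset.mem_range.mp hi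
      have hY0 : 0 ≤ Y := (abs_nonneg _).trans (hY i hi')
      -- The difference of the two sides is `i (n - i - 1) ≥ 0`.
      have hexp : n ≤ (n - i) * (i + 1) := by
        obtain ⟨j, rfl⟩ := Nat.exists_eq_add_of_lt hi'
        rw [show i + j + 1 - i = j + 1 by omega]
        nlinarith [Nat.zero_le (i * j)]
      rw [abs_mul, abs_mul, abs_of_pos (pow_pos hq0 _)]
      exact mul_le_mul (mul_le_mul (hY i hi') (hM _) (abs_nonneg _) hY0)
        (pow_le_pow_of_le_one hq0.le hq1.le hexp) (by positivity) (by positivity)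
    refine (Finset.sum_le_sum hterm).trans (le_of_eq ?_)
    rw [Finset.sum_const, Finset.card_range, nsmul_eq_mul]
    ring
  have hε : Tendsto (fun n : ℕ => (n : ℝ) * q ^ n * M) atTop (𝓝 0) := by
    simpa using (tendsto_self_mul_const_pow_of_lt_one hq0.le hq1).mul_const M
  obtain ⟨N, hN⟩ := eventually_atTop.mp (hε.eventually_le_const (show (0 : ℝ) < 1 / 2 by norm_num))
  -- Chosen so that `|x n| ≤ M + Y / 2 ≤ Y` for `n ≥ N`, while the finite sum covers `n < N`.
  set Y : ℝ := 2 * M + ∑ i ∈ Finset.range N, |x i| with hYdef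
  have hS0 : 0 ≤ ∑ i ∈ Finset.range N, |x i| := Finset.sum_nonneg fun _ _ => abs_nonneg _
  have hbd : ∀ n, |x n| ≤ Y := by
    intro n
    induction n using Nat.strong_induction_on with
    | _ n ih =>
      rcases lt_or_ge n N with hn | hn
      · have := Finset.single_le_sum (f := fun i => |x i|) (fun _ _ => abs_nonneg _)
          (Finset.mem_range.mpr hn)
        linarith
      · have h1 := hstep n Y ih
        have h2 := mul_le_mul_of_nonneg_right (hN n hn) (show 0 ≤ Y by positivity)
        have h3 := abs_sub_abs_le_abs_sub (x n) (d n)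
        have h4 := hM n
        linarith
  have hdiff : Tendsto (fun n => x n - d n) atTop (𝓝 0) := by
    refine squeeze_zero_norm (fun n => hstep n Y fun i _ => hbd i) ?_
    simpa using hε.mul_const Y
  simpa using hdiff.add hd

theorem IsRightInverse.coeff_recursion {q : ℝ} (hq0 : 0 < q) (hq1 : q < 1) {φ g : ℝ⟦X⟧}
    (hφ0 : PowerSeries.constantCoeff φ = 0)
    (hg : IsRightInverse q (PowerSeries.X * (1 - φ)) g) (ζ : ℝ) (n : ℕ) :
    PowerSeries.coeff (n + 1) g * ζ ^ n * q ^ (n + 1).choose 2 =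
      prodCoeff q φ n * ζ ^ n - ∑ i ∈ Finset.range n,
        PowerSeries.coeff (i + 1) g * ζ ^ i * q ^ (i + 1).choose 2 *
          (prodCoeff q φ (n - i) * ζ ^ (n - i)) * q ^ ((n - i) * (i + 1)) := by
  have h1 := congrArg (PowerSeries.coeff (n + 1)) (hg.mul_denomSeries hq0 hq1 hφ0)
  have hq : ∀ m : ℕ, q ^ m ≠ 0 := fun m => (pow_pos hq0 m).ne'
  rw [PowerSeries.coeff_succ_X_mul, PowerSeries.coeff_rescale, PowerSeries.coeff_mul,
    Finset.Nat.sum_antidiagonal_eq_sum_range_succ (fun i j =>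
      PowerSeries.coeff i g * PowerSeries.coeff j (denomSeries q φ)), Finset.sum_range_succ',
    PowerSeries.coeff_zero_eq_constantCoeff_apply, hg.1, zero_mul, add_zero,
    Finset.sum_range_succ, Nat.sub_self, PowerSeries.coeff_zero_eq_constantCoeff_apply,
    constantCoeff_denomSeries, mul_one] at h1
  have h2 := choose_two_add n 1
  have h3 : q⁻¹ ^ n * PowerSeries.coeff n (denomSeries q φ) * q ^ (n + 1).choose 2 =
      prodCoeff q φ n := by
    rw [denomSeries, PowerSeries.coeff_mk, h2, pow_add, pow_add]
    simp
    field_simp [hq]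
  have h4 : ∀ i ∈ Finset.range n,
      PowerSeries.coeff (i + 1) g * ζ ^ i * q ^ (i + 1).choose 2 *
          (prodCoeff q φ (n - i) * ζ ^ (n - i)) * q ^ ((n - i) * (i + 1)) =
        PowerSeries.coeff (i + 1) g *
          PowerSeries.coeff (n + 1 - (i + 1)) (denomSeries q φ) *
          (ζ ^ n * q ^ (n + 1).choose 2) := by
    intro i hi
    obtain ⟨j, rfl⟩ := Nat.exists_eq_add_of_le (Finset.mem_range.mp hi).le
    rw [show i + j + 1 - (i + 1) = j by omega, Nat.add_sub_cancel_left,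
      show i + j + 1 = (i + 1) + j by ring, choose_two_add (i + 1) j, denomSeries,
      PowerSeries.coeff_mk, pow_add _ _ (_ * _), pow_add _ (Nat.choose _ _), pow_add ζ, inv_pow,
      mul_comm j]
    field_simp [hq]
  rw [Finset.sum_congr rfl h4, ← Finset.sum_mul, ← h3]
  linear_combination (ζ ^ n * q ^ (n + 1).choose 2) * h1

/-! ### Relating `φ` to `θ`, and the product of the values of `θ` -/

theorem dslope_toFun_eq {φ : ℝ⟦X⟧} (hΦ : Differentiable ℂ (toFun φ)) {ζ : ℝ} (hζ : 0 < ζ)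
    (hφζ : toFun φ ζ = 1) {θ : ℂ → ℂ} (hθ : MeromorphicNFAt θ (ζ : ℂ)) (hθζ : θ ζ ≠ 0)
    (hφθ : ∀ z : ℂ, z ≠ ζ → toFun φ z = 1 - (1 - z / ζ) * θ z) (z : ℂ) :
    dslope (toFun φ) ζ z = θ z / ζ := by
  have hζ' : (ζ : ℂ) ≠ 0 := by exact_mod_cast hζ.ne'
  have hne : ∀ z : ℂ, z ≠ ζ → dslope (toFun φ) ζ z = θ z / ζ := fun z hz => by
    have hz' : z - ζ ≠ 0 := sub_ne_zero.mpr hz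
    rw [dslope_of_ne _ hz, slope_def_field, hφζ, hφθ z hz, div_eq_div_iff hz' hζ']
    field_simp
    ring
  rcases ne_or_eq z ζ with hz | rfl
  · exact hne z hz
  -- The factorization is given only off `ζ`, so the value there comes by continuity. For `θ`,
  -- normal form with a nonzero value means order zero, hence analyticity at `ζ`.
  have h1 : ContinuousAt (dslope (toFun φ) (ζ : ℂ)) ζ := continuousAt_dslope_same.mpr (hΦ _)
  have h2 : ContinuousAt (fun z => θ z / ζ) ζ :=
    (hθ.meromorphicOrderAt_nonneg_iff_analyticAt.mp
      (hθ.meromorphicOrderAt_eq_zero_iff.mpr hθζ).ge).continuousAt.div_const _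
  exact tendsto_nhds_unique (l := 𝓝[≠] (ζ : ℂ)) ((h1.tendsto.mono_left nhdsWithin_le_nhds).congr'
    (eventually_nhdsWithin_of_forall hne)) (h2.tendsto.mono_left nhdsWithin_le_nhds)

theorem toFun_ofReal (φ : ℝ⟦X⟧) (x : ℝ) :
    toFun φ x = ((∑' n, PowerSeries.coeff n φ * x ^ n : ℝ) : ℂ) := by
  rw [Complex.ofReal_tsum, toFun]
  simp

/-- The values of `φ` along `ζ q, ζ q ^ 2, …` are dominated by a geometric sequence. -/
theorem tsum_coeff_mul_pow_le {φ : ℝ⟦X⟧} (hφ0 : PowerSeries.constantCoeff φ = 0)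
    (hφ : ∀ n : ℕ, 0 ≤ PowerSeries.coeff n φ) {ζ : ℝ} (hζ : 0 < ζ)
    (hsum : HasSum (fun n => PowerSeries.coeff n φ * ζ ^ n) 1) {y : ℝ} (hy0 : 0 ≤ y)
    (hy1 : y ≤ 1) : ∑' n, PowerSeries.coeff n φ * (ζ * y) ^ n ≤ y := by
  have hle : ∀ n, PowerSeries.coeff n φ * (ζ * y) ^ n ≤ y * (PowerSeries.coeff n φ * ζ ^ n) := by
    intro n
    rcases Nat.eq_zero_or_pos n with rfl | hn
    · simp [hφ0]
    · have h1 : y ^ n ≤ y := pow_le_of_le_one hy0 hy1 hn.ne'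
      have h2 : 0 ≤ PowerSeries.coeff n φ * ζ ^ n := mul_nonneg (hφ n) (by positivity)
      calc PowerSeries.coeff n φ * (ζ * y) ^ n = y ^ n * (PowerSeries.coeff n φ * ζ ^ n) := by
            rw [mul_pow]; ring
        _ ≤ _ := mul_le_mul_of_nonneg_right h1 h2
  have h3 := hsum.mul_left y
  rw [mul_one] at h3
  exact hasSum_le hle (Summable.of_nonneg_of_le (fun n => mul_nonneg (hφ n) (by positivity)) hle
    h3.summable).hasSum h3

/-- Each `t j` is the quotient of `1 - a j` by `1 - q^(j+1)`, and both `a j` and `q^(j+1)` are at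
most geometric, so the two products converge absolutely. -/
theorem multipliable_theta {q : ℝ} (hq0 : 0 < q) (hq1 : q < 1) {a : ℕ → ℝ} {t : ℕ → ℂ}
    (ha0 : ∀ j, 0 ≤ a j) (ha1 : ∀ j, a j ≤ q ^ (j + 1))
    (hat : ∀ j, ((1 - a j : ℝ) : ℂ) = (1 - (q : ℂ) ^ (j + 1)) * t j) :
    Multipliable t ∧
      Tendsto (fun n => ((∏ j ∈ Finset.range n, (1 - a j) : ℝ) : ℂ)) atTop
        (𝓝 ((qPochhammerInf q q : ℂ) * ∏' j, t j)) := by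
  have hgeo : Summable fun j : ℕ => q ^ (j + 1) :=
    (summable_nat_add_iff 1).mpr (summable_geometric_of_lt_one hq0.le hq1)
  have hA : Multipliable fun j => ((1 - a j : ℝ) : ℂ) := by
    have h1 : Summable fun j => ‖((-a j : ℝ) : ℂ)‖ := by
      refine Summable.of_nonneg_of_le (fun _ => norm_nonneg _) (fun j => ?_) hgeo
      rw [Complex.norm_real, norm_neg, Real.norm_of_nonneg (ha0 j)]
      exact ha1 j
    simpa [sub_eq_add_neg] using multipliable_one_add_of_summable h1
  have hQ' : ∀ j : ℕ, (1 - (q : ℂ) ^ (j + 1)) ≠ 0 := fun j => by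
    have : (1 - q ^ (j + 1) : ℝ) ≠ 0 := (sub_pos.mpr (pow_lt_one₀ hq0.le hq1 (by simp))).ne'
    exact_mod_cast this
  have hI : Multipliable fun j : ℕ => (1 - (q : ℂ) ^ (j + 1))⁻¹ := by
    have h1 : Summable fun j : ℕ => ‖((q ^ (j + 1) / (1 - q ^ (j + 1)) : ℝ) : ℂ)‖ := by
      refine Summable.of_nonneg_of_le (fun _ => norm_nonneg _) (fun j => ?_)
        (hgeo.div_const (1 - q))
      have h2 : q ^ (j + 1) ≤ q := pow_le_of_le_one hq0.le hq1.le (by simp)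
      have h3 : 0 < 1 - q := by linarith
      have h4 : 0 < 1 - q ^ (j + 1) := by linarith
      rw [Complex.norm_real, Real.norm_of_nonneg (by positivity)]
      gcongr
    refine (multipliable_one_add_of_summable h1).congr fun j => ?_
    have := hQ' j
    push_cast
    field_simp
    ring
  have ht : Multipliable t := by
    refine (hA.mul hI).congr fun j => ?_
    rw [hat j]
    have := hQ' j
    field_simp
  refine ⟨ht, ?_⟩
  have hP : Multipliable fun j : ℕ => 1 - (q : ℂ) * (q : ℂ) ^ j := by
    have h1 : Summable fun j : ℕ => ‖-((q : ℂ) * (q : ℂ) ^ j)‖ := by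
      refine hgeo.congr fun j => ?_
      rw [norm_neg, ← pow_succ', norm_pow, Complex.norm_real, Real.norm_of_nonneg hq0.le]
    simpa [sub_eq_add_neg] using multipliable_one_add_of_summable h1
  have hPe : (qPochhammerInf q q : ℂ) = ∏' j : ℕ, (1 - (q : ℂ) * (q : ℂ) ^ j) := by
    have h1 := (multipliable_qPochhammerInf q q (by rwa [abs_of_pos hq0])).map_tprod
      Complex.ofRealHom Complex.continuous_ofReal
    simpa [qPochhammerInf] using h1
  rw [hPe, ← hP.tprod_mul ht]
  have h5 : (fun j : ℕ => (1 - (q : ℂ) * (q : ℂ) ^ j) * t j) = fun j => ((1 - a j : ℝ) : ℂ) := by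
    funext j
    rw [hat j, pow_succ']
  rw [h5]
  refine hA.hasProd.tendsto_prod_nat.congr fun n => ?_
  rw [Complex.ofReal_prod]

end QLagrange

/-! ### The asymptotic formula -/

theorem proposition2p5 (q : ℝ) (hq0 : 0 < q) (hq1 : q < 1)
    (φ g : PowerSeries ℝ) (hφ0 : PowerSeries.constantCoeff φ = 0)
    (hg : QLagrange.IsRightInverse q (PowerSeries.X * (1 - φ)) g)
    (hφ_nonneg : ∀ n : ℕ, 0 ≤ PowerSeries.coeff n φ)
    (hφ_limsup : Filter.limsup (QLagrange.logRatio φ) Filter.atTop < ((-2 : ℝ) : EReal))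
    (ζ : ℝ) (hζ : 0 < ζ) (hφζ : QLagrange.toFun φ ζ = 1)
    (θ : ℂ → ℂ) (hθ : MeromorphicNFOn θ Set.univ)
    (hφθ : ∀ z : ℂ, z ≠ ζ → QLagrange.toFun φ z = 1 - (1 - z / ζ) * θ z)
    (hθ_root : ∀ z : ℂ, ‖z‖ ≤ ζ → θ z ≠ 0) :
    DifferentiableAt ℂ (QLagrange.toFun φ) ζ ∧
    Multipliable (fun j : ℕ => θ (ζ * q ^ (j + 1))) ∧
    Asymptotics.IsEquivalent Filter.atTop
      (fun n : ℕ => ((PowerSeries.coeff n g : ℝ) : ℂ))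
      (fun n : ℕ => 1 / ((q : ℂ) ^ n.choose 2 * (ζ : ℂ) ^ n *
        deriv (QLagrange.toFun φ) ζ * (QLagrange.qPochhammerInf q q : ℂ) *
        ∏' j : ℕ, θ (ζ * q ^ (j + 1)))) := by
  open QLagrange in
  have hsum : ∀ r : ℝ, 0 ≤ r → Summable fun n => PowerSeries.coeff n φ * r ^ n :=
    fun r hr => summable_coeff_mul_pow hφ_nonneg hφ_limsup hr
  have hΦ := differentiable_toFun hφ_nonneg hsum
  have hζ' : (ζ : ℂ) ≠ 0 := by exact_mod_cast hζ.ne'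
  have hslope := dslope_toFun_eq hΦ hζ hφζ (hθ (Set.mem_univ _))
    (hθ_root ζ (by rw [Complex.norm_of_nonneg hζ.le])) hφθ
  have hslope_ne : ∀ z : ℂ, ‖z‖ ≤ ζ → dslope (toFun φ) ζ z ≠ 0 := fun z hz => by
    rw [hslope]
    exact div_ne_zero (hθ_root z hz) hζ'
  have hderiv : deriv (toFun φ) ζ ≠ 0 := by
    rw [← dslope_same]
    exact hslope_ne ζ (by rw [Complex.norm_of_nonneg hζ.le])
  have hsum1 : HasSum (fun n => PowerSeries.coeff n φ * ζ ^ n) 1 := by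
    rw [toFun_ofReal, Complex.ofReal_eq_one] at hφζ
    rw [← hφζ]
    exact (hsum ζ hζ.le).hasSum
  set a : ℕ → ℝ := fun j => ∑' n, PowerSeries.coeff n φ * (ζ * q ^ (j + 1)) ^ n with ha
  have hlt : ∀ j : ℕ, q ^ (j + 1) < 1 := fun j => pow_lt_one₀ hq0.le hq1 (by simp)
  have hat : ∀ j, ((1 - a j : ℝ) : ℂ) = (1 - (q : ℂ) ^ (j + 1)) * θ (ζ * q ^ (j + 1)) := by
    intro j
    have hne : (ζ : ℂ) * q ^ (j + 1) ≠ ζ := by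
      have : ζ * q ^ (j + 1) ≠ ζ := by
        have := mul_lt_of_lt_one_right hζ (hlt j)
        exact this.ne
      exact_mod_cast this
    have h1 := hφθ _ hne
    have h2 := toFun_ofReal φ (ζ * q ^ (j + 1))
    push_cast at h2
    rw [mul_div_cancel_left₀ _ hζ', h2] at h1
    rw [ha]
    push_cast
    rw [h1]
    ring
  obtain ⟨hmul, hprod⟩ := multipliable_theta hq0 hq1 (a := a)
    (t := fun j => θ (ζ * q ^ (j + 1)))
    (fun j => tsum_nonneg fun n => mul_nonneg (hφ_nonneg n) (by positivity))
    (fun j => tsum_coeff_mul_pow_le hφ0 hφ_nonneg hζ hsum1 (by positivity) (hlt j).le) hat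
  refine ⟨hΦ _, hmul, ?_⟩
  obtain ⟨M, hM'⟩ := exists_prodCoeff_mul_pow_le hq0 hq1 hφ_nonneg hζ hsum1
  have hM : ∀ n, |prodCoeff q φ n * ζ ^ n| ≤ M := fun n => by
    rw [abs_of_nonneg (mul_nonneg (prodCoeff_nonneg hq0 hq1 hφ_nonneg n) (by positivity))]
    exact hM' n
  have hκ' := tendsto_pow_mul_coeff_inv hφ0 hφ_nonneg hsum hζ hφζ hslope_ne
  -- The sequence is real, so its complex limit is too; real parts bring the limit back to `ℝ`.
  have hκ : Tendsto (fun n : ℕ => ζ ^ (n + 1) * PowerSeries.coeff n (1 - φ)⁻¹) atTop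
      (𝓝 ((deriv (toFun φ) ζ)⁻¹).re) :=
    ((Complex.continuous_re.tendsto _).comp hκ').congr fun n => Complex.ofReal_re _
  set κ : ℝ := ((deriv (toFun φ) ζ)⁻¹).re
  have hκeq : (κ : ℂ) = (deriv (toFun φ) ζ)⁻¹ :=
    tendsto_nhds_unique ((Complex.continuous_ofReal.tendsto _).comp hκ) hκ'
  have hd := tendsto_prodCoeff_mul_pow hq0 hq1 hφ0 hM hκ
  set S : ℝ := ∑' k, prodCoeff q φ k * ζ ^ k * q ^ k
  have hS : (S : ℂ) * ((qPochhammerInf q q : ℂ) * ∏' j : ℕ, θ (ζ * q ^ (j + 1))) = 1 := by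
    have h1 := (Complex.continuous_ofReal.tendsto _).comp
      (tendsto_tsum_prodCoeff_mul_prod hq0 hq1 hφ0 hsum hζ hM)
    refine tendsto_nhds_unique (hprod.const_mul (S : ℂ)) ?_
    rw [Complex.ofReal_one] at h1
    exact h1.congr fun n => by rw [Function.comp_apply, Complex.ofReal_mul]
  have hd2 : Tendsto (fun n => prodCoeff q φ n * ζ ^ n) atTop (𝓝 (ζ⁻¹ * (κ * S))) :=
    (hd.const_mul ζ⁻¹).congr fun n => inv_mul_cancel_left₀ hζ.ne' _
  have hE := tendsto_of_perturbed_recursion hq0 hq1 hM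
    (fun n => hg.coeff_recursion hq0 hq1 hφ0 ζ n) hd2
  refine Asymptotics.isEquivalent_of_tendsto_one ?_
  -- The recursion describes `g_(n+1)` with weight `ζ^n`; the extra factor `ζ` in `hlim` completes
  -- `ζ^(n+1)`.
  rw [← tendsto_add_atTop_iff_nat 1]
  have hlim := ((Complex.continuous_ofReal.tendsto _).comp hE).mul_const ((ζ : ℂ) *
    (deriv (toFun φ) ζ * ((qPochhammerInf q q : ℂ) * ∏' j : ℕ, θ (ζ * q ^ (j + 1)))))
  have hone : ((ζ⁻¹ * (κ * S) : ℝ) : ℂ) * ((ζ : ℂ) *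
    (deriv (toFun φ) ζ * ((qPochhammerInf q q : ℂ) * ∏' j : ℕ, θ (ζ * q ^ (j + 1))))) = 1 := by
    push_cast
    rw [hκeq, ← hS]
    field_simp
  rw [hone] at hlim
  refine hlim.congr fun n => ?_
  rw [Function.comp_apply, Pi.div_apply, div_div_eq_mul_div, div_one]
  push_cast
  ring
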